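/- Let $X$ be a nonzero real Banach space with closed unit ball $B_X$. A slice of $B_X$ is a set of the form $\{x\in B_X : x^*(x)>1-\varepsilon\}$ with $x^*\in X^*$, $\|x^*\|=1$ and $\varepsilon>0$. Suppose that $X$ has the strong diameter 2 property, that is, every finite convex combination of slices $$\sum_{i=1}^n\lambda_iS_i=\Big\{\sum_{i=1}^n\lambda_ix_i : x_i\in S_i\Big\},\qquad \lambda_i\ge 0,\ \sum_{i=1}^n\lambda_i=1,\ S_1,\dots,S_n\text{ slices of }B_X,$$ has diameter $2$. Then the bidual $X^{**}$ contains an isometric copy of $L_1[0,1]$; that is, there is a linear isometry from the real Banach space $L_1[0,1]$ (with respect to Lebesgue measure) into $X^{**}$. -/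

import Mathlib

open MeasureTheory

/-- `S` is a slice of the closed unit ball `B_X` of the real normed space `X`: there are a
norm-one functional `f` and `ε > 0` with `S = {x ∈ B_X : f x > 1 - ε}`. -/
def IsUnitBallSlice {X : Type*} [NormedAddCommGroup X] [NormedSpace ℝ X] (S : Set X) : Prop :=
  ∃ f : StrongDual ℝ X, ‖f‖ = 1 ∧ ∃ ε : ℝ, 0 < ε ∧
    S = {x : X | x ∈ Metric.closedBall (0 : X) 1 ∧ 1 - ε < f x}

/-- The combination `∑ i, w i • S i` of sets: all sums `∑ i, w i • x i` with `x i ∈ S i`. -/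
def setCombination {X : Type*} [NormedAddCommGroup X] [NormedSpace ℝ X] {n : ℕ}
    (w : Fin n → ℝ) (S : Fin n → Set X) : Set X :=
  {y : X | ∃ x : Fin n → X, (∀ i, x i ∈ S i) ∧ y = ∑ i, w i • x i}

/-- The strong diameter 2 property: every finite convex combination of slices of the closed
unit ball has diameter 2. (All these sets are bounded, so that `Metric.diam` is the
true diameter.) -/
def StrongDiameterTwoProperty (X : Type*) [NormedAddCommGroup X] [NormedSpace ℝ X] : Prop :=
  ∀ (n : ℕ) (w : Fin n → ℝ) (S : Fin n → Set X),
    (∀ i, 0 ≤ w i) → ∑ i, w i = 1 → (∀ i, IsUnitBallSlice (S i)) →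
      Metric.diam (setCombination w S) = 2

/-! Two nearly antipodal points in an average of slices force the norm of `X*` to be octahedral
(`dual_octahedral`). Octahedrality yields unit vectors `f k` in `X*` with a lower `ℓ₁` estimate
whose weights `r k` tend to 1, so by Hahn-Banach a functional in the ball of `X**` may take any
values `c k` on them with `|c k| ≤ r k`. For each `t`, choose `ψ t` with value `r k * h k t` at `f
k`, where the `h k` run through a dense sequence of continuous functions into `[-1, 1]`, each
repeated infinitely often. The embedding is the weak* integral `g ↦ ∫ g t • ψ t`: it is a
contraction, and testing it on the `f k` recovers the `L₁` norm. Since `t ↦ ψ t` need not be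
measurable, `exists_averaging_operator` builds this integral as an ultrafilter limit of integrals
over step approximations. -/

open Filter Topology

/-! ### Octahedrality of the dual and almost isometric `ℓ₁` sequences -/

section Octahedral

variable {X : Type*} [NormedAddCommGroup X] [NormedSpace ℝ X]

/-- In the dual of a space with the strong diameter 2 property, finitely many unit vectors admit
a common unit vector that is almost `ℓ₁`-orthogonal to each of them. -/
lemma StrongDiameterTwoProperty.exists_almost_orthogonal (hX : StrongDiameterTwoProperty X)
    {n : ℕ} (hn : 0 < n) (F : Fin n → StrongDual ℝ X) (hF : ∀ i, ‖F i‖ = 1) {δ : ℝ} (hδ : 0 < δ)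
    (hδ1 : δ < 1) :
    ∃ g : StrongDual ℝ X, ‖g‖ = 1 ∧ ∀ i (t : ℝ), (1 - δ) * (1 + |t|) ≤ ‖F i + t • g‖ := by
  have hn' : (0 : ℝ) < n := by exact_mod_cast hn
  set S : Fin n → Set X := fun i => {x | x ∈ Metric.closedBall (0 : X) 1 ∧ 1 - δ < F i x}
  have hdiam := hX n (fun _ => (n : ℝ)⁻¹) S (fun _ => by positivity)
    (by simp [hn'.ne']) (fun i => ⟨F i, hF i, δ, hδ, rfl⟩)
  have hle : δ / n ≤ 1 := (div_le_one hn').2 (hδ1.le.trans (by exact_mod_cast hn))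
  -- A defect `δ / n` in the average is a defect `δ` in the sum; as each `g (x j) - g (y j)` is at
  -- most 2, each one alone exceeds `2 - δ`.
  obtain ⟨p, ⟨x, hx, rfl⟩, q, ⟨y, hy, rfl⟩, hpq⟩ :
      ∃ p ∈ setCombination (fun _ => (n : ℝ)⁻¹) S, ∃ q ∈ setCombination (fun _ => (n : ℝ)⁻¹) S,
        2 - δ / n < dist p q := by
    by_contra! h
    have := Metric.diam_le_of_forall_dist_le (by linarith) h
    have : 0 < δ / n := by positivity
    linarith
  rw [dist_eq_norm, ← Finset.sum_sub_distrib] at hpq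
  set z := ∑ i, ((n : ℝ)⁻¹ • x i - (n : ℝ)⁻¹ • y i) with hz
  obtain ⟨g, hg, hgz⟩ := exists_dual_vector ℝ z (by linarith)
  have hgle : ∀ v ∈ Metric.closedBall (0 : X) 1, |g v| ≤ 1 := fun v hv => by
    have := g.le_opNorm v
    rw [hg, one_mul, Real.norm_eq_abs] at this
    exact this.trans (by simpa using hv)
  have hpair : ∀ i, 2 - δ < g (x i) - g (y i) := by
    intro i
    have hnonneg : ∀ j ∈ Finset.univ, 0 ≤ 2 - (g (x j) - g (y j)) := fun j _ => by
      have h1 := abs_le.1 (hgle _ (hx j).1)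
      have h2 := abs_le.1 (hgle _ (hy j).1)
      linarith
    have h1 := Finset.single_le_sum hnonneg (Finset.mem_univ i)
    have h2 : g z = (n : ℝ)⁻¹ * ∑ j, (g (x j) - g (y j)) := by
      simp [hz, Finset.mul_sum, mul_sub]
    have h3 : 2 - δ / n < (n : ℝ)⁻¹ * ∑ j, (g (x j) - g (y j)) := by
      rw [← h2, hgz]; exact hpq
    have h4 : 2 * n - δ < ∑ j, (g (x j) - g (y j)) := by
      have := mul_lt_mul_of_pos_left h3 hn'
      field_simp at this
      linarith
    rw [Finset.sum_sub_distrib] at h1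
    simp only [Finset.sum_const, Finset.card_univ, Fintype.card_fin, nsmul_eq_mul] at h1
    linarith
  refine ⟨g, hg, fun i t => ?_⟩
  have h1 := abs_le.1 (hgle _ (hx i).1)
  have h2 := abs_le.1 (hgle _ (hy i).1)
  have h3 := hpair i
  have heval : ∀ v ∈ Metric.closedBall (0 : X) 1, F i v + t * g v ≤ ‖F i + t • g‖ := fun v hv =>
    calc F i v + t * g v = (F i + t • g) v := by simp
      _ ≤ ‖(F i + t • g) v‖ := Real.le_norm_self _
      _ ≤ ‖F i + t • g‖ * ‖v‖ := ContinuousLinearMap.le_opNorm _ _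
      _ ≤ ‖F i + t • g‖ := mul_le_of_le_one_right (norm_nonneg _) (by simpa using hv)
  -- By `hpair`, `g` is above `1 - δ` at `x i` and below `-(1 - δ)` at `y i`, while `F i` is above
  -- `1 - δ` at both; the sign of `t` selects the point.
  rcases le_total 0 t with ht | ht
  · have := heval _ (hx i).1
    have hxF := (hx i).2
    rw [abs_of_nonneg ht]
    nlinarith
  · have := heval _ (hy i).1
    have hyF := (hy i).2
    rw [abs_of_nonpos ht]
    nlinarith

/-- The dual of a space with the strong diameter 2 property is octahedral. -/
lemma StrongDiameterTwoProperty.dual_octahedral [Nontrivial X] (hX : StrongDiameterTwoProperty X)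
    (V : Submodule ℝ (StrongDual ℝ X)) [FiniteDimensional ℝ V] {δ : ℝ} (hδ : 0 < δ)
    (hδ1 : δ < 1) :
    ∃ g : StrongDual ℝ X, ‖g‖ = 1 ∧ ∀ f ∈ V, ∀ t : ℝ, (1 - δ) * (‖f‖ + |t|) ≤ ‖f + t • g‖ := by
  classical
  have : ProperSpace V := FiniteDimensional.proper_real V
  obtain ⟨N, hNs, hNfin, hN⟩ :=
    (isCompact_sphere (0 : V) 1).finite_cover_balls (half_pos hδ)
  obtain ⟨x₀, hx₀⟩ := exists_ne (0 : X)
  obtain ⟨f₀, hf₀, -⟩ := exists_dual_vector ℝ x₀ (norm_ne_zero_iff.2 hx₀)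
  -- Including `f₀` keeps `T` nonempty when `V` is trivial and its sphere empty.
  set T : Finset (StrongDual ℝ X) := insert f₀ (hNfin.toFinset.image Subtype.val) with hT
  have hT1 : ∀ f ∈ T, ‖f‖ = 1 := by
    intro f hf
    rw [hT, Finset.mem_insert, Finset.mem_image] at hf
    rcases hf with rfl | ⟨v, hv, rfl⟩
    · exact hf₀
    · exact mem_sphere_zero_iff_norm.1 (hNs (hNfin.mem_toFinset.1 hv))
  obtain ⟨g, hg, hgT⟩ := hX.exists_almost_orthogonal
    (Finset.card_pos.2 ⟨f₀, Finset.mem_insert_self _ _⟩)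
    (fun i => (T.equivFin.symm i : StrongDual ℝ X)) (fun i => hT1 _ (T.equivFin.symm i).2)
    (half_pos hδ) (by linarith)
  have hgT' : ∀ f ∈ T, ∀ t : ℝ, (1 - δ / 2) * (1 + |t|) ≤ ‖f + t • g‖ := fun f hf t => by
    simpa using hgT (T.equivFin ⟨f, hf⟩) t
  have hsphere : ∀ f ∈ V, ‖f‖ = 1 → ∀ t : ℝ, (1 - δ) * (1 + |t|) ≤ ‖f + t • g‖ := by
    intro f hf hf1 t
    have hmem : (⟨f, hf⟩ : V) ∈ Metric.sphere (0 : V) 1 := mem_sphere_zero_iff_norm.2 hf1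
    obtain ⟨v, hv, hdist⟩ := Set.mem_iUnion₂.1 (hN hmem)
    have hd : ‖f - v‖ < δ / 2 := by
      rw [← dist_eq_norm]
      exact hdist
    have h1 := hgT' v (Finset.mem_insert_of_mem
      (Finset.mem_image_of_mem _ (hNfin.mem_toFinset.2 hv))) t
    have h2 : ‖(v : StrongDual ℝ X) + t • g‖ ≤ ‖f + t • g‖ + ‖f - v‖ := by
      have := norm_sub_le (f + t • g) (f - v)
      rwa [show f + t • g - (f - v) = (v : StrongDual ℝ X) + t • g by abel] at this
    nlinarith [abs_nonneg t]
  refine ⟨g, hg, fun f hf t => ?_⟩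
  rcases eq_or_ne f 0 with rfl | hf0
  · simp only [norm_zero, zero_add, norm_smul, hg, mul_one, Real.norm_eq_abs]
    nlinarith [abs_nonneg t]
  · have hpos : 0 < ‖f‖ := norm_pos_iff.2 hf0
    have h := hsphere (‖f‖⁻¹ • f) (V.smul_mem _ hf) (norm_smul_inv_norm hf0) (‖f‖⁻¹ * t)
    have heq : ‖f‖⁻¹ • f + (‖f‖⁻¹ * t) • g = ‖f‖⁻¹ • (f + t • g) := by
      rw [smul_add, mul_smul]
    rw [heq, norm_smul, norm_inv, norm_norm, abs_mul, abs_inv, abs_norm] at h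
    have := mul_le_mul_of_nonneg_left h hpos.le
    field_simp at this
    linarith

/-- An asymptotically isometric copy of `ℓ₁` in an octahedral space. -/
lemma exists_asymptotically_isometric_l1 {Y : Type*} [NormedAddCommGroup Y] [NormedSpace ℝ Y]
    (hY : ∀ V : Submodule ℝ Y, FiniteDimensional ℝ V → ∀ δ : ℝ, 0 < δ → δ < 1 →
      ∃ g : Y, ‖g‖ = 1 ∧ ∀ f ∈ V, ∀ t : ℝ, (1 - δ) * (‖f‖ + |t|) ≤ ‖f + t • g‖)
    (r : ℕ → ℝ) (hr0 : ∀ k, 0 < r k) (hr : StrictMono r) (hr1 : ∀ k, r k < 1) :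
    ∃ f : ℕ → Y, (∀ k, ‖f k‖ = 1) ∧ ∀ (n : ℕ) (a : ℕ → ℝ),
      ∑ i ∈ Finset.range n, r i * |a i| ≤ ‖∑ i ∈ Finset.range n, a i • f i‖ := by
  have hstep : ∀ k (V : {V : Submodule ℝ Y // FiniteDimensional ℝ V}), ∃ g : Y, ‖g‖ = 1 ∧
      ∀ f ∈ V.1, ∀ t : ℝ, r k / r (k + 1) * (‖f‖ + |t|) ≤ ‖f + t • g‖ := by
    intro k V
    have hlt : r k / r (k + 1) < 1 := (div_lt_one (hr0 _)).2 (hr k.lt_succ_self)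
    have hpos : 0 < r k / r (k + 1) := div_pos (hr0 _) (hr0 _)
    obtain ⟨g, hg, h⟩ := hY V.1 V.2 (1 - r k / r (k + 1)) (by linarith) (by linarith)
    exact ⟨g, hg, by simpa using h⟩
  choose g hg1 hg using hstep
  let W : ℕ → {V : Submodule ℝ Y // FiniteDimensional ℝ V} := fun n =>
    Nat.rec ⟨⊥, inferInstance⟩ (fun k V => ⟨V.1 ⊔ Submodule.span ℝ {g k V}, by
      have := V.2
      infer_instance⟩) n
  have hW : ∀ k, (W (k + 1)).1 = (W k).1 ⊔ Submodule.span ℝ {g k (W k)} := fun k => rfl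
  have hsum : ∀ n (a : ℕ → ℝ), ∑ i ∈ Finset.range n, a i • g i (W i) ∈ (W n).1 := by
    intro n a
    induction n with
    | zero => simp
    | succ n ih =>
      rw [Finset.sum_range_succ, hW]
      exact add_mem (Submodule.mem_sup_left ih)
        (Submodule.smul_mem _ _ (Submodule.mem_sup_right (Submodule.mem_span_singleton_self _)))
  refine ⟨fun k => g k (W k), fun k => hg1 _ _, fun n a => ?_⟩
  -- The factor `r n` strengthens the claim so that the ratios `r k / r (k + 1)` telescope in the
  -- induction.
  have key : ∑ i ∈ Finset.range n, r i * |a i| ≤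
      r n * ‖∑ i ∈ Finset.range n, a i • g i (W i)‖ := by
    induction n with
    | zero => simp
    | succ n ih =>
      rw [Finset.sum_range_succ, Finset.sum_range_succ]
      have h := hg n (W n) _ (hsum n a) (a n)
      rw [div_mul_eq_mul_div, div_le_iff₀ (hr0 _)] at h
      linarith
  exact key.trans (mul_le_of_le_one_left (norm_nonneg _) (hr1 n).le)

/-- Hahn-Banach extension of a functional prescribed on an asymptotically isometric copy of
`ℓ₁`. -/
lemma exists_dual_apply_eq {Y : Type*} [NormedAddCommGroup Y] [NormedSpace ℝ Y] {f : ℕ → Y}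
    {r : ℕ → ℝ} (hr0 : ∀ k, 0 < r k)
    (hf : ∀ (n : ℕ) (a : ℕ → ℝ),
      ∑ i ∈ Finset.range n, r i * |a i| ≤ ‖∑ i ∈ Finset.range n, a i • f i‖)
    (c : ℕ → ℝ) (hc : ∀ k, |c k| ≤ r k) :
    ∃ ψ : StrongDual ℝ Y, ‖ψ‖ ≤ 1 ∧ ∀ k, ψ (f k) = c k := by
  -- Independence makes the prescription `f k ↦ c k` well defined on the span.
  have hli : LinearIndependent ℝ f := by
    rw [linearIndependent_iff']
    intro s a hs i hi
    obtain ⟨n, hn⟩ := s.exists_nat_subset_range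
    have h := hf n (fun j => if j ∈ s then a j else 0)
    simp only [ite_smul, zero_smul, Finset.sum_ite_mem, Finset.inter_eq_right.2 hn, hs,
      norm_zero] at h
    have hterm := Finset.single_le_sum (f := fun j => r j * |if j ∈ s then a j else 0|)
      (fun j _ => mul_nonneg (hr0 j).le (abs_nonneg _)) (hn hi)
    simp only [hi, if_true] at hterm
    have : r i * |a i| ≤ 0 := hterm.trans h
    have := nonpos_of_mul_nonpos_right this (hr0 i)
    exact abs_eq_zero.1 (le_antisymm this (abs_nonneg _))
  let p := Submodule.span ℝ (Set.range f)
  let φ : p →ₗ[ℝ] ℝ := Finsupp.linearCombination ℝ c ∘ₗ hli.repr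
  have hφ : ∀ x : p, ‖φ x‖ ≤ 1 * ‖x‖ := by
    intro x
    have hx : (x : Y) = Finsupp.linearCombination ℝ f (hli.repr x) :=
      (hli.linearCombination_repr x).symm
    obtain ⟨n, hn⟩ := (hli.repr x).support.exists_nat_subset_range
    have hsumf : (x : Y) = ∑ i ∈ Finset.range n, hli.repr x i • f i := by
      rw [hx, Finsupp.linearCombination_apply, Finsupp.sum_of_support_subset _ hn]
      simp
    have hsumc : φ x = ∑ i ∈ Finset.range n, hli.repr x i * c i := by
      change Finsupp.linearCombination ℝ c (hli.repr x) = _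
      rw [Finsupp.linearCombination_apply, Finsupp.sum_of_support_subset _ hn]
      · simp
      · simp
    rw [one_mul, hsumc, Submodule.coe_norm, hsumf, Real.norm_eq_abs]
    refine (Finset.abs_sum_le_sum_abs _ _).trans (le_trans ?_ (hf n _))
    refine Finset.sum_le_sum fun i _ => ?_
    rw [abs_mul, mul_comm]
    exact mul_le_mul_of_nonneg_right (hc i) (abs_nonneg _)
  obtain ⟨ψ, hψ, hnorm⟩ := exists_extension_norm_eq p (φ.mkContinuous 1 hφ)
  refine ⟨ψ, hnorm.trans_le (φ.mkContinuous_norm_le zero_le_one hφ), fun k => ?_⟩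
  have hk : f k ∈ p := Submodule.subset_span ⟨k, rfl⟩
  have h := hψ ⟨f k, hk⟩
  rw [h]
  change Finsupp.linearCombination ℝ c (hli.repr ⟨f k, hk⟩) = c k
  rw [hli.repr_eq_single k _ rfl]
  simp

end Octahedral

/-! ### Continuous functions norming `L₁` -/

section Norming

/-- The continuous functions with values in `[-1, 1]`. -/
abbrev UnitContinuousMap := ↥{h : C(ℝ, ℝ) | ∀ t, |h t| ≤ 1}

/-- Continuous functions bounded by one are norming for `L₁`. -/
lemma integral_abs_le_of_forall_continuous {μ : Measure ℝ} [IsFiniteMeasure μ] [μ.WeaklyRegular]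
    {g : ℝ → ℝ} (hg : Integrable g μ) {C : ℝ}
    (hC : ∀ h : UnitContinuousMap, ∫ t, g t * h.1 t ∂μ ≤ C) : ∫ t, |g t| ∂μ ≤ C := by
  have hkey : ∀ δ : ℝ, 0 < δ → ∫ t, |g t| ∂μ ≤ C + δ * (2 + μ.real Set.univ) := by
    intro δ hδ
    obtain ⟨u, hu, hui⟩ := hg.exists_boundedContinuous_integral_sub_le hδ
    have hden : ∀ t, 0 < |u t| + δ := fun t => by positivity
    -- A continuous substitute for the sign of `u`, losing at most `δ` pointwise.
    let h : UnitContinuousMap := ⟨⟨fun t => u t / (|u t| + δ),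
      u.continuous.div (u.continuous.abs.add continuous_const) fun t => (hden t).ne'⟩, fun t => by
        change |u t / (|u t| + δ)| ≤ 1
        rw [abs_div, abs_of_pos (hden t), div_le_one (hden t)]
        linarith⟩
    have hpt : ∀ t, |g t| ≤ g t * h.1 t + 2 * ‖g t - u t‖ + δ := by
      intro t
      have h1 : |h.1 t| ≤ 1 := h.2 t
      have h2 : |u t| - δ ≤ u t * h.1 t := by
        change |u t| - δ ≤ u t * (u t / (|u t| + δ))
        rw [← mul_div_assoc, le_div_iff₀ (hden t), ← abs_mul_abs_self (u t)]
        nlinarith [abs_nonneg (u t)]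
      have h3 : |g t| ≤ |u t| + |g t - u t| := by
        have := abs_add_le (u t) (g t - u t)
        rwa [add_sub_cancel] at this
      have h4 : (u t - g t) * h.1 t ≤ |g t - u t| := by
        refine (le_abs_self _).trans ?_
        rw [abs_mul, abs_sub_comm]
        exact mul_le_of_le_one_right (abs_nonneg _) h1
      rw [Real.norm_eq_abs]
      linarith
    have hgh : Integrable (fun t => g t * h.1 t) μ :=
      hg.mul_bdd (c := 1) h.1.continuous.aestronglyMeasurable (Eventually.of_forall h.2)
    have hgu : Integrable (fun t => 2 * ‖g t - u t‖) μ := ((hg.sub hui).norm).const_mul 2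
    calc ∫ t, |g t| ∂μ ≤ ∫ t, (g t * h.1 t + 2 * ‖g t - u t‖ + δ) ∂μ :=
          integral_mono hg.abs ((hgh.add hgu).add (integrable_const δ)) hpt
      _ = ∫ t, g t * h.1 t ∂μ + 2 * ∫ t, ‖g t - u t‖ ∂μ + μ.real Set.univ * δ := by
          have e1 : ∫ t, (g t * h.1 t + 2 * ‖g t - u t‖ + δ) ∂μ =
            ∫ t, (g t * h.1 t + 2 * ‖g t - u t‖) ∂μ + ∫ _, δ ∂μ :=
              integral_add (hgh.add hgu) (integrable_const δ)
          rw [e1, integral_add hgh hgu, integral_const_mul, integral_const, smul_eq_mul]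
      _ ≤ C + δ * (2 + μ.real Set.univ) := by linarith [hC h]
  have hlim : Tendsto (fun δ : ℝ => C + δ * (2 + μ.real Set.univ)) (𝓝[>] 0) (𝓝 C) := by
    have : Tendsto (fun δ : ℝ => C + δ * (2 + μ.real Set.univ)) (𝓝 0)
        (𝓝 (C + 0 * (2 + μ.real Set.univ))) := by
      exact (Continuous.tendsto (by fun_prop) 0)
    simp only [zero_mul, add_zero] at this
    exact this.mono_left nhdsWithin_le_nhds
  exact ge_of_tendsto hlim (eventually_mem_nhdsWithin.mono fun δ hδ => hkey δ hδ)

/-- The integral against a fixed integrable function is continuous for locally uniform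
convergence of bounded continuous functions. -/
lemma continuous_integral_mul_unitContinuousMap {μ : Measure ℝ} {g : ℝ → ℝ}
    (hg : Integrable g μ) : Continuous fun h : UnitContinuousMap => ∫ t, g t * h.1 t ∂μ := by
  refine continuous_of_dominated (bound := fun t => |g t|) (fun h => ?_) (fun h => ?_) hg.abs ?_
  · exact hg.aestronglyMeasurable.mul h.1.continuous.aestronglyMeasurable
  · refine Eventually.of_forall fun t => ?_
    rw [norm_mul, Real.norm_eq_abs, Real.norm_eq_abs]
    exact mul_le_of_le_one_right (abs_nonneg _) (h.2 t)
  · refine Eventually.of_forall fun t => ?_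
    exact continuous_const.mul ((continuous_eval_const t).comp continuous_subtype_val)

/-- Continuity of the integral in `h` carries the bound to the closure, so a countable family of
test functions suffices for all `g` at once. -/
lemma integral_abs_le_of_denseRange {μ : Measure ℝ} [IsFiniteMeasure μ] [μ.WeaklyRegular]
    {g : ℝ → ℝ} (hg : Integrable g μ) {ι : Type*} {d : ι → UnitContinuousMap}
    (hd : DenseRange d) {C : ℝ} (hC : ∀ i, ∫ t, g t * (d i).1 t ∂μ ≤ C) :
    ∫ t, |g t| ∂μ ≤ C :=
  integral_abs_le_of_forall_continuous hg fun h =>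
    hd.induction_on (p := fun h : UnitContinuousMap => ∫ t, g t * h.1 t ∂μ ≤ C) h
      (isClosed_le (continuous_integral_mul_unitContinuousMap hg) continuous_const) hC

end Norming

/-! ### Weak* averages without measurability -/

section Averages

variable {Y : Type*} [NormedAddCommGroup Y] [NormedSpace ℝ Y]

/-- The point of the grid of mesh `1 / n` that lies just below `t`. -/
noncomputable def gridPoint (n : ℕ) (t : ℝ) : ℝ := (⌊t * n⌋₊ : ℝ) / n

/-- The natural-number floor sends negative reals to 0, hence the restriction to the half-line. -/
lemma tendsto_gridPoint {t : ℝ} (ht : 0 ≤ t) :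
    Tendsto (fun n : ℕ => gridPoint n t) atTop (𝓝 t) :=
  (tendsto_nat_floor_mul_div_atTop ht).comp tendsto_natCast_atTop_atTop

/-- A function composed with the grid approximation is measurable, however irregular it is. -/
lemma measurable_comp_gridPoint (n : ℕ) (F : ℝ → ℝ) : Measurable fun t => F (gridPoint n t) :=
  (measurable_from_top (f := fun m : ℕ => F ((m : ℝ) / n))).comp
    (Nat.measurable_floor.comp (measurable_id.mul_const (n : ℝ)))

lemma abs_dual_apply_le {ψ : StrongDual ℝ Y} (hψ : ‖ψ‖ ≤ 1) (y : Y) : |ψ y| ≤ ‖y‖ := by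
  have := ψ.le_of_opNorm_le hψ y
  rwa [one_mul] at this

lemma integrable_mul_gridPoint {μ : Measure ℝ} {ψ : ℝ → StrongDual ℝ Y} (hψ : ∀ t, ‖ψ t‖ ≤ 1)
    {g : ℝ → ℝ} (hg : Integrable g μ) (n : ℕ) (y : Y) :
    Integrable (fun t => g t * ψ (gridPoint n t) y) μ :=
  hg.mul_bdd (c := ‖y‖) (measurable_comp_gridPoint n fun s => ψ s y).aestronglyMeasurable
    (Eventually.of_forall fun _ => abs_dual_apply_le (hψ _) y)

lemma abs_integral_mul_gridPoint_le {μ : Measure ℝ} {ψ : ℝ → StrongDual ℝ Y}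
    (hψ : ∀ t, ‖ψ t‖ ≤ 1) {g : ℝ → ℝ} (hg : Integrable g μ) (n : ℕ) (y : Y) :
    |∫ t, g t * ψ (gridPoint n t) y ∂μ| ≤ (∫ t, |g t| ∂μ) * ‖y‖ := by
  rw [← integral_mul_const, ← Real.norm_eq_abs]
  refine (norm_integral_le_integral_norm _).trans ?_
  refine integral_mono (integrable_mul_gridPoint hψ hg n y).norm (hg.abs.mul_const _) fun t => ?_
  change ‖g t * ψ (gridPoint n t) y‖ ≤ |g t| * ‖y‖
  rw [norm_mul]
  exact mul_le_mul_of_nonneg_left (abs_dual_apply_le (hψ _) y) (abs_nonneg _)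

/-- Averaging a bounded family of functionals, with no measurability in the parameter: there is a
contraction from `L₁` to the dual that acts as integration on the vectors `y` where
`t ↦ ψ t y` is continuous. -/
lemma exists_averaging_operator {μ : Measure ℝ} [IsFiniteMeasure μ] (hμ : ∀ᵐ t ∂μ, 0 ≤ t)
    {ψ : ℝ → StrongDual ℝ Y} (hψ : ∀ t, ‖ψ t‖ ≤ 1) :
    ∃ Φ : Lp ℝ 1 μ →ₗ[ℝ] StrongDual ℝ Y, (∀ g, ‖Φ g‖ ≤ ‖g‖) ∧
      ∀ (g : Lp ℝ 1 μ) (y : Y), Continuous (fun t => ψ t y) →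
        Φ g y = ∫ t, g t * ψ t y ∂μ := by
  let b : ℕ → Lp ℝ 1 μ → Y → ℝ := fun n g y => ∫ t, g t * ψ (gridPoint n t) y ∂μ
  have hint : ∀ g : Lp ℝ 1 μ, Integrable g μ := fun g => L1.integrable_coeFn g
  have hb : ∀ n g y, |b n g y| ≤ ‖g‖ * ‖y‖ := fun n g y => by
    rw [L1.norm_eq_integral_norm]
    exact abs_integral_mul_gridPoint_le hψ (hint g) n y
  -- Using one ultrafilter for all `g` and `y` makes the limits bilinear.
  have hex : ∀ (g : Lp ℝ 1 μ) (y : Y), ∃ l : ℝ,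
      Tendsto (fun n => b n g y) (hyperfilter ℕ) (𝓝 l) ∧ |l| ≤ ‖g‖ * ‖y‖ := by
    intro g y
    obtain ⟨l, hl, hlim⟩ := (isCompact_Icc (a := -(‖g‖ * ‖y‖)) (b := ‖g‖ * ‖y‖)).ultrafilter_le_nhds
      ((hyperfilter ℕ).map fun n => b n g y)
      (le_principal_iff.2 (mem_map.2 (univ_mem' fun n => abs_le.1 (hb n g y))))
    exact ⟨l, hlim, abs_le.2 hl⟩
  choose B hB hBle using hex
  let Φ : Lp ℝ 1 μ →ₗ[ℝ] Y →ₗ[ℝ] ℝ := LinearMap.mk₂ ℝ B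
    (fun g g' y => tendsto_nhds_unique (hB _ _) (((hB g y).add (hB g' y)).congr fun n => by
      change b n g y + b n g' y = b n (g + g') y
      rw [← integral_add (integrable_mul_gridPoint hψ (hint g) n y)
        (integrable_mul_gridPoint hψ (hint g') n y)]
      refine integral_congr_ae ?_
      filter_upwards [Lp.coeFn_add g g'] with _ ht
      rw [ht, Pi.add_apply, add_mul]))
    (fun c g y => tendsto_nhds_unique (hB _ _) (((hB g y).const_mul c).congr fun n => by
      change c * b n g y = b n (c • g) y
      rw [← integral_const_mul]
      refine integral_congr_ae ?_
      filter_upwards [Lp.coeFn_smul c g] with t ht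
      rw [ht, Pi.smul_apply, smul_eq_mul, mul_assoc]))
    (fun g y y' => tendsto_nhds_unique (hB _ _) (((hB g y).add (hB g y')).congr fun n => by
      rw [← integral_add (integrable_mul_gridPoint hψ (hint g) n y)
        (integrable_mul_gridPoint hψ (hint g) n y')]
      simp only [b, map_add, mul_add]))
    (fun c g y => tendsto_nhds_unique (hB _ _) (((hB g y).const_mul c).congr fun n => by
      change c * b n g y = b n g (c • y)
      rw [← integral_const_mul]
      simp only [b, map_smul, smul_eq_mul, mul_left_comm]))
  have hΦ : ∀ g y, ‖Φ g y‖ ≤ 1 * ‖g‖ * ‖y‖ := fun g y => by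
    rw [one_mul]; exact hBle g y
  refine ⟨(Φ.mkContinuous₂ 1 hΦ).toLinearMap, fun g => ?_, fun g y hy => ?_⟩
  · have := (Φ.mkContinuous₂ 1 hΦ).le_of_opNorm_le (Φ.mkContinuous₂_norm_le zero_le_one hΦ) g
    rwa [one_mul] at this
  · refine tendsto_nhds_unique (hB g y) (Tendsto.mono_left ?_ Nat.hyperfilter_le_atTop)
    refine tendsto_integral_of_dominated_convergence (fun t => |g t| * ‖y‖)
      (fun n => (integrable_mul_gridPoint hψ (hint g) n y).aestronglyMeasurable)
      ((hint g).abs.mul_const _) (fun n => Eventually.of_forall fun t => ?_) ?_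
    · rw [norm_mul]
      exact mul_le_mul_of_nonneg_left (abs_dual_apply_le (hψ _) y) (abs_nonneg _)
    · filter_upwards [hμ] with t ht
      exact ((hy.tendsto t).comp (tendsto_gridPoint ht)).const_mul (g t)

end Averages

/-! ### The isometric embedding -/

section Embedding

/-- The dual of an octahedral space contains `L₁(μ)` isometrically, for every finite measure `μ`
on the half-line. -/
lemma nonempty_linearIsometry_dual_of_octahedral {Y : Type*} [NormedAddCommGroup Y]
    [NormedSpace ℝ Y]
    (hY : ∀ V : Submodule ℝ Y, FiniteDimensional ℝ V → ∀ δ : ℝ, 0 < δ → δ < 1 →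
      ∃ g : Y, ‖g‖ = 1 ∧ ∀ f ∈ V, ∀ t : ℝ, (1 - δ) * (‖f‖ + |t|) ≤ ‖f + t • g‖)
    {μ : Measure ℝ} [IsFiniteMeasure μ] [μ.WeaklyRegular] (hμ : ∀ᵐ t ∂μ, 0 ≤ t) :
    Nonempty (Lp ℝ 1 μ →ₗᵢ[ℝ] StrongDual ℝ Y) := by
  let r : ℕ → ℝ := fun k => 1 - 1 / ((k : ℝ) + 2)
  have hr : StrictMono r := strictMono_nat_of_lt_succ fun k => by
    have : 1 / (((k + 1 : ℕ) : ℝ) + 2) < 1 / ((k : ℝ) + 2) :=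
      one_div_lt_one_div_of_lt (by positivity) (by push_cast; linarith)
    simp only [r]
    linarith
  have hr0 : ∀ k, 0 < r k := fun k => by
    have : 1 / ((k : ℝ) + 2) < 1 :=
      (div_lt_one (by positivity)).2 (by linarith [k.cast_nonneg (α := ℝ)])
    simp only [r]
    linarith
  have hr1 : ∀ k, r k < 1 := fun k => sub_lt_self _ (by positivity)
  have hrlim : Tendsto r atTop (𝓝 1) := by
    have h : Tendsto (fun k : ℕ => 1 / ((k : ℝ) + 2)) atTop (𝓝 0) :=
      tendsto_const_nhds.div_atTop
        (tendsto_atTop_add_const_right _ _ tendsto_natCast_atTop_atTop)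
    simpa [r] using h.const_sub 1
  obtain ⟨f, hf1, hf⟩ := exists_asymptotically_isometric_l1 hY r hr0 hr hr1
  have : Nonempty UnitContinuousMap := ⟨⟨0, fun t => by simp⟩⟩
  let d : ℕ → UnitContinuousMap := TopologicalSpace.denseSeq UnitContinuousMap
  -- Each `d j` recurs at every index `Nat.pair j m`, so `r` can tend to 1 along these indices while
  -- the test function stays fixed.
  let h : ℕ → UnitContinuousMap := fun k => d k.unpair.1
  have hψ : ∀ t : ℝ, ∃ ψ : StrongDual ℝ Y, ‖ψ‖ ≤ 1 ∧ ∀ k, ψ (f k) = r k * (h k).1 t := fun t =>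
    exists_dual_apply_eq hr0 hf _ fun k => by
      rw [abs_mul, abs_of_pos (hr0 k)]
      exact mul_le_of_le_one_right (hr0 k).le ((h k).2 t)
  choose ψ hψ1 hψ using hψ
  obtain ⟨Φ, hΦle, hΦ⟩ := exists_averaging_operator hμ hψ1
  refine ⟨⟨Φ, fun g => le_antisymm (hΦle g) ?_⟩⟩
  rw [L1.norm_eq_integral_norm]
  refine integral_abs_le_of_denseRange (L1.integrable_coeFn g)
    (TopologicalSpace.denseRange_denseSeq UnitContinuousMap) fun j => ?_
  have hk : ∀ k, r k * ∫ t, g t * (h k).1 t ∂μ ≤ ‖Φ g‖ := fun k => by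
    have hcont : Continuous fun t => ψ t (f k) := by
      simp only [hψ]
      exact continuous_const.mul (h k).1.continuous
    have heq : Φ g (f k) = r k * ∫ t, g t * (h k).1 t ∂μ := by
      rw [hΦ g (f k) hcont, ← integral_const_mul]
      simp only [hψ, mul_left_comm]
    rw [← heq]
    refine (Real.le_norm_self _).trans (((Φ g).le_opNorm _).trans ?_)
    rw [hf1, mul_one]
  have hlim : Tendsto (fun m => r (Nat.pair j m) * ∫ t, g t * (d j).1 t ∂μ) atTop
      (𝓝 (1 * ∫ t, g t * (d j).1 t ∂μ)) :=
    (hrlim.comp (tendsto_atTop_mono (fun m => Nat.right_le_pair j m) tendsto_id)).mul_const _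
  rw [one_mul] at hlim
  refine le_of_tendsto' hlim fun m => ?_
  simpa [h] using hk (Nat.pair j m)

end Embedding

theorem theorem2p4 (X : Type*) [NormedAddCommGroup X] [NormedSpace ℝ X] [CompleteSpace X]
    [Nontrivial X] (hX : StrongDiameterTwoProperty X) :
    Nonempty
      (Lp ℝ 1 (volume.restrict (Set.Icc (0 : ℝ) 1)) →ₗᵢ[ℝ] StrongDual ℝ (StrongDual ℝ X)) := by
  refine nonempty_linearIsometry_dual_of_octahedral
    (fun V _ _ hδ hδ1 => hX.dual_octahedral V hδ hδ1) ?_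
  filter_upwards [ae_restrict_mem measurableSet_Icc] with t ht using ht.1
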